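/- Let $\beta>1$ be a real number that is not an integer, and let $\tau_\beta:[0,1]\to[0,1]$, $\tau_\beta(x)=\beta x-\lfloor \beta x\rfloor$. Let $BV$ be the space of functions $f:[0,1]\to\mathbb{C}$ of bounded variation with norm $\|f\|_{BV}=\operatorname{var}(f)+\sup|f|$, let $\mathcal{N}\subset BV$ be the subspace of functions vanishing outside a countable set, and let $\widehat{BV}=BV/\mathcal{N}$ with the quotient norm. Let $\mathcal{L}_\beta$ be the Perron-Frobenius operator on $\widehat{BV}$, induced by $\mathcal{L}_\beta f(x)=\frac1\beta\sum_{y\in[0,1],\ \tau_\beta(y)=x}f(y)$. An eigenvalue $\lambda\in\mathbb{C}$ of $\mathcal{L}_\beta$ on $\widehat{BV}$ is called non-leading if $|\lambda|>1/\beta$ and $\lambda\neq1$. An eigenfunctional for $\lambda\in\mathbb{C}$ is a nonzero linear functional $\nu:\widehat{BV}\to\mathbb{C}$ with $\nu(\mathcal{L}_\beta f)=\lambda\,\nu(f)$ for all $f\in\widehat{BV}$. (a) If $\lambda$ is a non-leading eigenvalue of $\mathcal{L}_\beta$ and $\nu$ is an eigenfunctional for $\lambda$, then there is no complex measure $m$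 on $[0,1]$ such that $\nu(f)=\int_{[0,1]} f\,dm$ for every $f\in BV$ (where $\nu(f)$ means $\nu$ of the class of $f$). (b) In contrast, for the leading eigenvalue $1$, the functional $f\mapsto\int_0^1 f(x)\,dx$ on $\widehat{BV}$ is a bounded eigenfunctional, and every bounded eigenfunctional for $1$ is a scalar multiple of it. -/

import Mathlib

open MeasureTheory

noncomputable section

namespace BetaTransfer

/-- The closed unit interval `[0,1]`, as a type. -/
abbrev I : Type := Set.Icc (0 : ℝ) 1

/-- The beta-map `τ_β(x) = βx - [βx]` on `[0,1]`. -/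
def betaMap (β : ℝ) (x : I) : I :=
  ⟨Int.fract (β * (x : ℝ)), Int.fract_nonneg _, (Int.fract_lt_one _).le⟩

/-- The Perron-Frobenius operator of the beta-map on arbitrary functions,
`f ↦ (x ↦ β⁻¹ ∑_{y ∈ [0,1], τ_β(y) = x} f(y))`.  For `β > 1` the sum is finite. -/
def transfer (β : ℝ) (f : I → ℂ) (x : I) : ℂ :=
  (β : ℂ)⁻¹ * ∑ᶠ (y : I) (_ : betaMap β y = x), f y

theorem bv_add {f g : I → ℂ} (hf : BoundedVariationOn f Set.univ)
    (hg : BoundedVariationOn g Set.univ) : BoundedVariationOn (f + g) Set.univ := by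
  have h : eVariationOn (f + g) Set.univ ≤
      eVariationOn f Set.univ + eVariationOn g Set.univ := by
    refine iSup_le fun p => ?_
    refine le_trans ?_ (add_le_add (eVariationOn.sum_le (f := f) (n := p.1) p.2.2.1 p.2.2.2)
      (eVariationOn.sum_le (f := g) (n := p.1) p.2.2.1 p.2.2.2))
    rw [← Finset.sum_add_distrib]
    exact Finset.sum_le_sum fun i _ => edist_add_add_le _ _ _ _
  exact ne_top_of_le_ne_top (ENNReal.add_ne_top.2 ⟨hf, hg⟩) h

theorem bv_const (c : ℂ) : BoundedVariationOn (fun _ : I => c) Set.univ := by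
  unfold BoundedVariationOn
  rw [eVariationOn.constant_on]
  · simp
  · rintro _ ⟨_, _, rfl⟩ _ ⟨_, _, rfl⟩
    rfl

theorem bv_sum {ι : Type*} (s : Finset ι) (g : ι → I → ℂ)
    (h : ∀ i ∈ s, BoundedVariationOn (g i) Set.univ) :
    BoundedVariationOn (fun x => ∑ i ∈ s, g i x) Set.univ := by
  classical
  induction s using Finset.induction_on with
  | empty => simpa using bv_const 0
  | insert a s ha ih =>
    have h1 := bv_add (h a (Finset.mem_insert_self a s))
      (ih fun i hi => h i (Finset.mem_insert_of_mem hi))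
    convert h1 using 1
    funext x
    simp [Finset.sum_insert ha]

/-- The space `BV` of functions `[0,1] → ℂ` of bounded variation. -/
def BV : Submodule ℂ (I → ℂ) where
  carrier := {f | BoundedVariationOn f Set.univ}
  add_mem' := fun hf hg => bv_add hf hg
  zero_mem' := bv_const 0
  smul_mem' := fun c _ hf => (bv_const c).smul hf

/-- The norm `var(f) + sup |f|` on `BV`. -/
def bvNorm (f : BV) : ℝ :=
  (eVariationOn (f : I → ℂ) Set.univ).toReal + ⨆ x : I, ‖(f : I → ℂ) x‖

/-- The subspace of those functions in `BV` that vanish outside a countable set. -/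
def nullBV : Submodule ℂ BV where
  carrier := {f | {x : I | (f : I → ℂ) x ≠ 0}.Countable}
  add_mem' := by
    intro f g hf hg
    refine (Set.Countable.union hf hg).mono fun x hx => ?_
    by_contra hcon
    simp only [Set.mem_union, Set.mem_ofPred_eq, not_or, not_not] at hcon
    exact hx (by simp [hcon.1, hcon.2])
  zero_mem' := by simp
  smul_mem' := by
    intro c f hf
    refine Set.Countable.mono (fun x hx => ?_) hf
    intro hcon
    exact hx (by simp [hcon])

/-- The quotient space `BV / 𝓝` of functions of bounded variation modulo equality off a
countable set. -/
abbrev BVhat : Type := BV ⧸ nullBV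

/-- The class in `BV / 𝓝` of a function of bounded variation. -/
abbrev toHat (f : BV) : BVhat := nullBV.mkQ f

/-- The quotient norm on `BV / 𝓝`: the infimum of the `BV`-norms of the representatives. -/
def hatNorm (F : BVhat) : ℝ :=
  ⨅ f : {f : BV // toHat f = F}, bvNorm f.1

/-- The inverse branch `x ↦ (x + i) / β` (truncated to `[0,1]`). -/
def branch (β : ℝ) (i : ℕ) (x : I) : I :=
  Set.projIcc 0 1 zero_le_one (((x : ℝ) + i) / β)

/-- The points at which the inverse branch number `i` is defined. -/
def branchDomain (β : ℝ) (i : ℕ) : Set I :=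
  {x | (x : ℝ) < 1 ∧ (x : ℝ) + i ≤ β}

theorem branch_coe {β : ℝ} (hβ : 1 < β) {i : ℕ} {x : I} (hx : x ∈ branchDomain β i) :
    ((branch β i x : I) : ℝ) = ((x : ℝ) + i) / β := by
  have h0 : (0 : ℝ) < β := by linarith
  have hmem : ((x : ℝ) + i) / β ∈ Set.Icc (0 : ℝ) 1 := by
    refine ⟨div_nonneg (add_nonneg x.2.1 (Nat.cast_nonneg i)) h0.le, ?_⟩
    rw [div_le_one h0]
    exact hx.2
  unfold branch
  rw [Set.projIcc_of_mem zero_le_one hmem]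

theorem betaMap_eq_iff {β : ℝ} (hβ : 1 < β) (x y : I) :
    betaMap β y = x ↔ ∃ i ∈ Finset.range (⌊β⌋₊ + 1), x ∈ branchDomain β i ∧ branch β i x = y := by
  have h0 : (0 : ℝ) < β := by linarith
  constructor
  · intro h
    have hx : Int.fract (β * (y : ℝ)) = (x : ℝ) := congrArg Subtype.val h
    have hnn : 0 ≤ β * (y : ℝ) := mul_nonneg h0.le y.2.1
    have hle : β * (y : ℝ) ≤ β := mul_le_of_le_one_right h0.le y.2.2
    have hsum : (x : ℝ) + (⌊β * (y : ℝ)⌋₊ : ℝ) = β * (y : ℝ) := by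
      rw [← hx, natCast_floor_eq_intCast_floor hnn]
      exact Int.fract_add_floor _
    have hdom : x ∈ branchDomain β ⌊β * (y : ℝ)⌋₊ :=
      ⟨by rw [← hx]; exact Int.fract_lt_one _, by rw [hsum]; exact hle⟩
    refine ⟨⌊β * (y : ℝ)⌋₊, ?_, hdom, ?_⟩
    · exact Finset.mem_range.2 (Nat.lt_succ_of_le (Nat.floor_le_floor hle))
    · apply Subtype.ext
      rw [branch_coe hβ hdom, hsum]
      field_simp
  · rintro ⟨i, -, hdom, rfl⟩
    apply Subtype.ext
    show Int.fract (β * ((branch β i x : I) : ℝ)) = (x : ℝ)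
    rw [branch_coe hβ hdom, mul_div_cancel₀ _ h0.ne', Int.fract_add_natCast]
    exact Int.fract_eq_self.2 ⟨x.2.1, hdom.1⟩

open Classical in
/-- The Perron-Frobenius operator written with the inverse branches. -/
theorem transfer_eq_sum {β : ℝ} (hβ : 1 < β) (f : I → ℂ) (x : I) :
    transfer β f x = (β : ℂ)⁻¹ * ∑ i ∈ Finset.range (⌊β⌋₊ + 1),
      if x ∈ branchDomain β i then f (branch β i x) else 0 := by
  have h0 : (0 : ℝ) < β := by linarith
  unfold transfer
  congr 1
  have hset : ∀ y : I, betaMap β y = x ↔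
      y ∈ (((Finset.range (⌊β⌋₊ + 1)).filter (fun i => x ∈ branchDomain β i)).image
        (fun i => branch β i x)) := by
    intro y
    rw [betaMap_eq_iff hβ]
    simp only [Finset.mem_image, Finset.mem_filter, and_assoc]
  simp only [hset]
  rw [finsum_mem_finset_eq_sum, Finset.sum_image, Finset.sum_filter]
  intro i hi j hj hij
  have hi' := (Finset.mem_filter.1 hi).2
  have hj' := (Finset.mem_filter.1 hj).2
  have h1 : ((branch β i x : I) : ℝ) = ((branch β j x : I) : ℝ) := congrArg Subtype.val hij
  rw [branch_coe hβ hi', branch_coe hβ hj', div_left_inj' h0.ne'] at h1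
  exact_mod_cast add_left_cancel h1

theorem bv_indicator_lower {s : Set I} (hs : IsLowerSet s) :
    BoundedVariationOn (s.indicator fun _ => (1 : ℂ)) Set.univ := by
  classical
  have hm : MonotoneOn (fun x : I => if x ∈ s then (0 : ℝ) else 1) Set.univ := by
    intro x _ y _ hxy
    by_cases hy : y ∈ s
    · simp [hy, hs hxy hy]
    · by_cases hx : x ∈ s <;> simp [hx, hy]
  have hb : BoundedVariationOn (fun x : I => if x ∈ s then (0 : ℝ) else 1) Set.univ := by
    refine hm.boundedVariationOn (C := 1) fun x _ => ?_
    by_cases hx : x ∈ s <;> simp [hx]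
  have hL : LipschitzWith 1 (fun t : ℝ => (1 : ℂ) - (t : ℂ)) := by
    refine LipschitzWith.of_dist_le_mul fun a b => ?_
    rw [dist_sub_left, NNReal.coe_one, one_mul, Complex.dist_of_im_eq (by simp)]
    simp
  have := hL.comp_boundedVariationOn hb
  convert this using 1
  funext x
  by_cases hx : x ∈ s <;> simp [hx]

theorem transfer_mem {β : ℝ} (hβ : 1 < β) {f : I → ℂ} (hf : f ∈ BV) : transfer β f ∈ BV := by
  classical
  have h0 : (0 : ℝ) < β := by linarith
  have hfun : transfer β f = (β : ℂ)⁻¹ • fun x => ∑ i ∈ Finset.range (⌊β⌋₊ + 1),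
      ((branchDomain β i).indicator (fun _ => (1 : ℂ)) • (f ∘ branch β i)) x := by
    funext x
    rw [transfer_eq_sum hβ]
    simp [Set.indicator_apply]
  rw [hfun]
  refine BV.smul_mem _ (bv_sum _ _ fun i _ => ?_)
  refine BoundedVariationOn.smul (f := (branchDomain β i).indicator fun _ => (1 : ℂ)) ?_ ?_
  · refine bv_indicator_lower fun x y hxy hx => ?_
    have hxy' : (y : ℝ) ≤ x := hxy
    exact ⟨lt_of_le_of_lt hxy' hx.1, by linarith [hx.2]⟩
  · refine ne_top_of_le_ne_top hf (eVariationOn.comp_le_of_monotoneOn f (branch β i) ?_ ?_)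
    · intro x _ y _ hxy
      have hxy' : (x : ℝ) ≤ y := hxy
      refine Set.monotone_projIcc _ ?_
      gcongr
    · exact fun _ _ => Set.mem_univ _

/-- The Perron-Frobenius operator `𝓛_β : BV → BV`, for `β > 1`. -/
def transferBV (β : ℝ) (hβ : 1 < β) : BV →ₗ[ℂ] BV where
  toFun f := ⟨transfer β f, transfer_mem hβ f.2⟩
  map_add' f g := by
    classical
    apply Subtype.ext
    funext x
    simp only [Submodule.coe_add, Pi.add_apply, transfer_eq_sum hβ]
    rw [← mul_add, ← Finset.sum_add_distrib]
    congr 1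
    refine Finset.sum_congr rfl fun i _ => ?_
    split_ifs <;> simp
  map_smul' c f := by
    classical
    apply Subtype.ext
    funext x
    simp only [Submodule.coe_smul, Pi.smul_apply, transfer_eq_sum hβ, RingHom.id_apply,
      smul_eq_mul]
    rw [mul_left_comm]
    congr 1
    rw [Finset.mul_sum]
    refine Finset.sum_congr rfl fun i _ => ?_
    split_ifs <;> simp

theorem transferBV_null (β : ℝ) (hβ : 1 < β) :
    nullBV ≤ nullBV.comap (transferBV β hβ) := by
  intro f hf
  refine Set.Countable.mono (fun x hx => ?_) (Set.Countable.image hf (betaMap β))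
  by_contra hcon
  refine hx ?_
  show transfer β f x = 0
  unfold transfer
  have : ∀ y : I, betaMap β y = x → (f : I → ℂ) y = 0 := by
    intro y hy
    by_contra hne
    exact hcon ⟨y, hne, hy⟩
  have h0 : ∑ᶠ (y : I) (_ : betaMap β y = x), (f : I → ℂ) y = 0 :=
    finsum_eq_zero_of_forall_eq_zero fun y => by
      rw [finsum_congr_Prop rfl (this y), finsum_zero]
  rw [h0, mul_zero]

/-- The Perron-Frobenius operator `𝓛_β` induced on `BV / 𝓝`, for `β > 1`. -/
def transferHat (β : ℝ) (hβ : 1 < β) : BVhat →ₗ[ℂ] BVhat :=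
  nullBV.mapQ nullBV (transferBV β hβ) (transferBV_null β hβ)

/-- `lam` is a non-leading eigenvalue: an eigenvalue of `𝓛_β` on `BV / 𝓝`, other than `1`, whose
modulus exceeds the essential spectral radius `1/β`.  Such spectral values are automatically
isolated and of finite multiplicity, so this is not required separately. -/
def IsNonLeadingEigenvalue (β : ℝ) (hβ : 1 < β) (lam : ℂ) : Prop :=
  Module.End.HasEigenvalue (transferHat β hβ) lam ∧ 1 / β < ‖lam‖ ∧ lam ≠ 1

/-- `ν` is an eigenfunctional for `lam`: a nonzero linear functional on `BV / 𝓝` with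
`ν ∘ 𝓛_β = lam • ν`, i.e. an eigenvector of the dual operator. -/
def IsEigenfunctional (β : ℝ) (hβ : 1 < β) (lam : ℂ) (ν : Module.Dual ℂ BVhat) : Prop :=
  Module.End.HasEigenvector (transferHat β hβ).dualMap lam ν

/-- `ν` is bounded with respect to the quotient norm of `BV / 𝓝`. -/
def IsBoundedFunctional (ν : Module.Dual ℂ BVhat) : Prop :=
  ∃ C : ℝ, ∀ F : BVhat, ‖ν F‖ ≤ C * hatNorm F

/-- The integral `∫ f dm` of a complex function against a complex measure on `[0,1]`. -/
def complexIntegral (m : ComplexMeasure I) (f : I → ℂ) : ℂ :=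
  m.integral f (ContinuousLinearMap.mul ℝ ℂ)

end BetaTransfer

end

open MeasureTheory

noncomputable section

namespace BetaTransfer


/-! Let `ν` be an eigenfunctional for `λ` with `|λ| > 1/β`, and let `F y` be the value of `ν` on the
indicator of `[0,y)`. The transfer operator sends such an indicator to `1/β` times a sum of
indicators of the same kind, so `F` is self-similar with ratio `κ = 1/(βλ)`, and `|κ| < 1`
(`isSelfSimilar_of_eigen`).

A bounded `ν` is determined by `ν(1)` (`eq_zero_of_eigen`). If `ν(1) = 0`, the contraction by `κ`
kills `F`; modulo step functions `β𝓛` is a sum over branches that does not increase variation, so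
the same contraction kills `ν` on all of `BV`. Applied to `ν - ν(1)∫`, this is the uniqueness in
(b).

For (a), if `ν` comes from a measure, then `F` has bounded variation and `F 1 ≠ 0`. Comparing the
variation of `F` on `[0,y]` with a linear function gives `|κ| ≤ 1/β` (`IsSelfSimilar.norm_le`).
Comparing `|F|` with a linear function then gives `|F y| ≤ |F 1| y`, and the functional equation at
`y = 1` becomes an equality case of the triangle inequality. It forces `κ = 1/β`
(`IsSelfSimilar.eq_inv`), hence `λ = 1`. -/

/-- A function bounded below that dominates a contraction of one of its other values is
nonnegative. -/
theorem nonneg_of_contraction {X : Type*} {s : Set X} {G : X → ℝ} {c B : ℝ} (hc : 0 ≤ c) (hc1 : c < 1)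
    (hB : ∀ y ∈ s, -B ≤ G y) (h : ∀ y ∈ s, ∃ z ∈ s, c * G z ≤ G y) :
    ∀ y ∈ s, 0 ≤ G y := by
  have key : ∀ n : ℕ, ∀ y ∈ s, -(c ^ n * B) ≤ G y := by
    intro n
    induction n with
    | zero => simpa using hB
    | succ n ih =>
      intro y hy
      obtain ⟨z, hz, hzy⟩ := h y hy
      have := mul_le_mul_of_nonneg_left (ih z hz) hc
      rw [pow_succ]
      linarith
  intro y hy
  have ht : Filter.Tendsto (fun n : ℕ => -(c ^ n * B)) Filter.atTop (nhds 0) := by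
    simpa using ((tendsto_pow_atTop_nhds_zero_of_lt_one hc hc1).mul_const B).neg
  exact le_of_tendsto' ht fun n => key n y hy

/-! ### Self-similar functions on the unit interval -/

/-- `F` satisfies the functional equation of the distribution function of an eigenfunctional:
on the `i`-th branch of the beta-map it is an affine copy of itself, scaled by `κ`. -/
def IsSelfSimilar (β : ℝ) (κ : ℂ) (F : ℝ → ℂ) : Prop :=
  F 0 = 0 ∧ ∀ (i : ℕ) (y : ℝ), y ≤ 1 → (i : ℝ) ≤ β * y → β * y ≤ i + 1 →
    F y = κ * (i * F 1 + F (β * y - i))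

theorem exists_floor {β y : ℝ} (hβ : 1 < β) (hy : y ∈ Set.Icc (0 : ℝ) 1) :
    ∃ i : ℕ, (i : ℝ) ≤ β * y ∧ β * y ≤ i + 1 ∧ β * y - i ∈ Set.Icc (0 : ℝ) 1 := by
  have h0 : 0 ≤ β * y := mul_nonneg (by linarith) hy.1
  have h1 := Nat.floor_le h0
  have h2 := (Nat.lt_floor_add_one (β * y)).le
  exact ⟨⌊β * y⌋₊, h1, h2, by linarith, by linarith⟩

theorem IsSelfSimilar.eq_zero {β : ℝ} {κ : ℂ} {F : ℝ → ℂ} (hF : IsSelfSimilar β κ F) (hβ : 1 < β)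
    (hκ : ‖κ‖ < 1) {B : ℝ} (hB : ∀ y, ‖F y‖ ≤ B) (h1 : F 1 = 0) :
    ∀ y ∈ Set.Icc (0 : ℝ) 1, F y = 0 := by
  have := nonneg_of_contraction (s := Set.Icc (0 : ℝ) 1) (G := fun y => -‖F y‖)
    (norm_nonneg κ) hκ (fun y _ => neg_le_neg (hB y)) (fun y hy => by
      obtain ⟨i, hi, hi', hz⟩ := exists_floor hβ hy
      refine ⟨_, hz, ?_⟩
      simp [hF.2 i y hy.2 hi hi', h1])
  intro y hy
  exact norm_le_zero_iff.1 (by linarith [this y hy])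

/-- Undoing the affine map `z ↦ κ(iF(1) + z)` is Lipschitz with constant `‖κ‖⁻¹`, and
reparametrising by a monotone branch does not increase variation. -/
theorem IsSelfSimilar.variation_ge {β : ℝ} {κ : ℂ} {F : ℝ → ℂ} (hF : IsSelfSimilar β κ F)
    (hβ : 1 < β) (hκ : κ ≠ 0) (hbv : BoundedVariationOn F Set.univ) {i : ℕ} {y : ℝ} (hy : y ≤ 1)
    (hi' : β * y ≤ i + 1) :
    ‖κ‖ * (eVariationOn F (Set.Icc 0 (β * y - i))).toReal ≤
      (eVariationOn F (Set.Icc (i / β) y)).toReal := by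
  have h0 : 0 < β := by linarith
  set φ : ℝ → ℝ := fun t => (t + i) / β
  have hφ : Monotone φ := fun a b hab => by
    show (a + i) / β ≤ (b + i) / β
    gcongr
  have hlip : LipschitzWith ‖κ⁻¹‖₊ (fun z : ℂ => κ⁻¹ * z - i * F 1) := by
    refine LipschitzWith.of_dist_le_mul fun a b => ?_
    rw [dist_sub_right, dist_eq_norm, dist_eq_norm, ← mul_sub, norm_mul, coe_nnnorm]
  have hmaps : Set.MapsTo φ (Set.Icc 0 (β * y - i)) (Set.Icc (i / β) y) := by
    rintro t ⟨ht0, ht1⟩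
    refine ⟨?_, ?_⟩
    · show (i : ℝ) / β ≤ (t + i) / β
      gcongr
      linarith
    · show (t + i) / β ≤ y
      rw [div_le_iff₀ h0]
      linarith
  have h1 : eVariationOn F (Set.Icc 0 (β * y - i)) =
      eVariationOn ((fun z : ℂ => κ⁻¹ * z - i * F 1) ∘ (F ∘ φ)) (Set.Icc 0 (β * y - i)) := by
    refine eVariationOn.congr fun t ht => ?_
    have h2 : β * φ t = t + i := mul_div_cancel₀ _ h0.ne'
    have h3 := hF.2 i (φ t) ((hmaps ht).2.trans hy) (by rw [h2]; linarith [ht.1])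
      (by rw [h2]; linarith [ht.2])
    simp only [Function.comp_apply]
    rw [h3, h2, inv_mul_cancel_left₀ hκ, add_sub_cancel_right]
    ring
  have h2 : eVariationOn F (Set.Icc 0 (β * y - i)) ≤
      ‖κ⁻¹‖₊ * eVariationOn F (Set.Icc (i / β) y) := by
    rw [h1]
    refine (hlip.lipschitzOnWith.comp_eVariationOn_le (Set.mapsTo_univ _ _)).trans ?_
    gcongr
    exact eVariationOn.comp_le_of_monotoneOn F φ (hφ.monotoneOn _) hmaps
  have h3 := ENNReal.toReal_mono
    (ENNReal.mul_ne_top ENNReal.coe_ne_top (hbv.mono (Set.subset_univ _))) h2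
  rw [ENNReal.toReal_mul, ENNReal.coe_toReal, coe_nnnorm, norm_inv] at h3
  rw [← le_inv_mul_iff₀ (norm_pos_iff.2 hκ)]
  exact h3

theorem toReal_eVariationOn_Icc_add {F : ℝ → ℂ} (hbv : BoundedVariationOn F Set.univ) {a b c : ℝ}
    (hab : a ≤ b) (hbc : b ≤ c) :
    (eVariationOn F (Set.Icc a c)).toReal =
      (eVariationOn F (Set.Icc a b)).toReal + (eVariationOn F (Set.Icc b c)).toReal := by
  have := eVariationOn.Icc_add_Icc F hab hbc (Set.mem_univ b)
  simp only [Set.univ_inter] at this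
  rw [← this, ENNReal.toReal_add (hbv.mono (Set.subset_univ _)) (hbv.mono (Set.subset_univ _))]

/-- A self-similar function of bounded variation is scaled by at most the contraction ratio of
the branches. -/
theorem IsSelfSimilar.norm_le {β : ℝ} {κ : ℂ} {F : ℝ → ℂ} (hF : IsSelfSimilar β κ F)
    (hβ : 1 < β) (hbv : BoundedVariationOn F Set.univ) (h1 : F 1 ≠ 0) : ‖κ‖ ≤ β⁻¹ := by
  have h0 : 0 < β := by linarith
  by_contra! hlt
  have hκ : κ ≠ 0 := by
    rintro rfl
    rw [norm_zero] at hlt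
    exact absurd hlt (not_lt.2 (by positivity))
  set V : ℝ → ℝ := fun y => (eVariationOn F (Set.Icc 0 y)).toReal with hV
  have hV0 : ∀ y, 0 ≤ V y := fun y => ENNReal.toReal_nonneg
  have hv : 0 < V 1 := by
    have := (hbv.mono (Set.subset_univ (Set.Icc (0 : ℝ) 1))).dist_le
      (x := 1) (y := 0) (by simp) (by simp)
    rw [hF.1, dist_zero_right] at this
    exact lt_of_lt_of_le (norm_pos_iff.2 h1) this
  -- Each full branch interval `[j/β, (j+1)/β]` with `j < i` carries variation at least `‖κ‖ V(1)`.
  have hnode : ∀ i : ℕ, (i : ℝ) ≤ β → i * (‖κ‖ * V 1) ≤ V (i / β) := by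
    intro i
    induction i with
    | zero => intro _; simpa using hV0 0
    | succ i ih =>
      intro hi
      push_cast at hi ⊢
      have h2 : β * ((i + 1) / β) = i + 1 := mul_div_cancel₀ _ h0.ne'
      have h3 := hF.variation_ge hβ hκ hbv (i := i) (y := (i + 1) / β)
        ((div_le_one h0).2 hi) h2.le
      rw [h2, add_sub_cancel_left] at h3
      have h4 : V ((i + 1) / β) = V (i / β) + _ := toReal_eVariationOn_Icc_add hbv
        (b := (i : ℝ) / β) (by positivity) (by gcongr; linarith)
      have h5 := ih (by linarith)
      rw [h4]
      linarith
  have hrec : ∀ (i : ℕ) (y : ℝ), y ≤ 1 → (i : ℝ) ≤ β * y → β * y ≤ i + 1 →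
      ‖κ‖ * (i * V 1 + V (β * y - i)) ≤ V y := by
    intro i y hy hi hi'
    have h4 : V y = V (i / β) + _ := toReal_eVariationOn_Icc_add hbv
        (b := (i : ℝ) / β) (by positivity) (by rw [div_le_iff₀ h0]; linarith)
    have h5 := hnode i (hi.trans (by nlinarith))
    have h6 := hF.variation_ge hβ hκ hbv hy hi'
    rw [h4]
    linarith
  -- The linear function `V(1) y` satisfies the recursion with ratio exactly `β⁻¹`; the surplus `‖κ‖
  -- - β⁻¹` is left as a separate term.
  have hdiff : ∀ (i : ℕ) (y : ℝ), y ≤ 1 → (i : ℝ) ≤ β * y → β * y ≤ i + 1 →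
      β⁻¹ * (V (β * y - i) - V 1 * (β * y - i)) + (‖κ‖ - β⁻¹) * (i * V 1 + V (β * y - i)) ≤
        V y - V 1 * y := by
    intro i y hy hi hi'
    have h2 : y = β⁻¹ * (i + (β * y - i)) := by field_simp; ring
    have h3 := hrec i y hy hi hi'
    have h4 : V 1 * y = V 1 * (β⁻¹ * (i + (β * y - i))) := by rw [← h2]
    rw [h4]
    linarith
  have hD := nonneg_of_contraction (s := Set.Icc (0 : ℝ) 1) (G := fun y => V y - V 1 * y)
    (inv_nonneg.2 h0.le) (inv_lt_one_of_one_lt₀ hβ) (B := V 1)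
    (fun y hy => by nlinarith [hV0 y, hy.1, hy.2]) (fun y hy => by
      obtain ⟨i, hi, hi', hz⟩ := exists_floor hβ hy
      refine ⟨_, hz, le_trans ?_ (hdiff i y hy.2 hi hi')⟩
      have : 0 ≤ (‖κ‖ - β⁻¹) * (i * V 1 + V (β * y - i)) :=
        mul_nonneg (by linarith) (add_nonneg (mul_nonneg (Nat.cast_nonneg i) hv.le) (hV0 _))
      simpa using this)
  have hfl : (1 : ℝ) ≤ (⌊β⌋₊ : ℝ) := by exact_mod_cast (Nat.one_le_floor_iff β).2 hβ.le
  have hle := Nat.floor_le h0.le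
  have hlt1 := Nat.lt_floor_add_one β
  have h6 := hdiff ⌊β⌋₊ 1 le_rfl (by rwa [mul_one]) (by rw [mul_one]; exact hlt1.le)
  -- At `y = 1` the right side of `hdiff` is `0`, while the surplus term is strictly positive
  -- because `⌊β⌋ ≥ 1`: a contradiction.
  have h7 := hD (β * 1 - ⌊β⌋₊) ⟨by linarith, by linarith⟩
  have h8 : 0 < (‖κ‖ - β⁻¹) * (⌊β⌋₊ * V 1 + V (β * 1 - ⌊β⌋₊)) :=
    mul_pos (by linarith) (by nlinarith [hV0 (β * 1 - ⌊β⌋₊)])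
  have h9 := mul_nonneg (inv_nonneg.2 h0.le) h7
  linarith

/-- A nontrivial self-similar function of bounded variation is scaled by exactly the contraction
ratio of the branches. -/
theorem IsSelfSimilar.eq_inv {β : ℝ} {κ : ℂ} {F : ℝ → ℂ} (hF : IsSelfSimilar β κ F)
    (hβ : 1 < β) (hbv : BoundedVariationOn F Set.univ) (h1 : F 1 ≠ 0) {B : ℝ}
    (hB : ∀ y, ‖F y‖ ≤ B) : κ * β = 1 := by
  have h0 : 0 < β := by linarith
  have hκ := hF.norm_le hβ hbv h1
  -- This yields `‖F y‖ ≤ ‖F 1‖ y` on the unit interval.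
  have hD := nonneg_of_contraction (s := Set.Icc (0 : ℝ) 1) (G := fun y => ‖F 1‖ * y - ‖F y‖)
    (inv_nonneg.2 h0.le) (inv_lt_one_of_one_lt₀ hβ) (B := B)
    (fun y hy => by
      have := mul_nonneg (norm_nonneg (F 1)) hy.1
      linarith [hB y]) (fun y hy => by
      obtain ⟨i, hi, hi', hz⟩ := exists_floor hβ hy
      refine ⟨_, hz, ?_⟩
      have h2 : ‖F y‖ ≤ β⁻¹ * (i * ‖F 1‖ + ‖F (β * y - i)‖) := by
        rw [hF.2 i y hy.2 hi hi', norm_mul]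
        refine mul_le_mul hκ ((norm_add_le _ _).trans ?_) (norm_nonneg _) (inv_nonneg.2 h0.le)
        simp
      have h3 : ‖F 1‖ * y = ‖F 1‖ * (β⁻¹ * (i + (β * y - i))) := by
        congr 1
        field_simp
        ring
      rw [h3]
      linarith)
  have hfl : (1 : ℝ) ≤ (⌊β⌋₊ : ℝ) := by exact_mod_cast (Nat.one_le_floor_iff β).2 hβ.le
  have hle := Nat.floor_le h0.le
  have hlt1 := Nat.lt_floor_add_one β
  have h6 := hF.2 ⌊β⌋₊ 1 le_rfl (by rwa [mul_one]) (by rw [mul_one]; exact hlt1.le)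
  have h7 := hD (β * 1 - ⌊β⌋₊) ⟨by linarith, by linarith⟩
  rw [mul_one] at h6 h7
  generalize hN : ⌊β⌋₊ = N at *
  set w : ℂ := F (β - N) / F 1 with hw
  have h8 : κ * (N + w) = 1 := by
    rw [hw]
    field_simp
    exact h6.symm
  have h9 : ‖w‖ ≤ β - N := by
    rw [hw, norm_div, div_le_iff₀ (norm_pos_iff.2 h1)]
    linarith
  have h10 : β ≤ ‖(N : ℂ) + w‖ := by
    have h11 : ‖κ‖ * ‖(N : ℂ) + w‖ = 1 := by rw [← norm_mul, h8, norm_one]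
    have h12 : 1 ≤ β⁻¹ * ‖(N : ℂ) + w‖ := by
      rw [← h11]
      gcongr
    rwa [le_inv_mul_iff₀ h0, mul_one] at h12
  have h11 : ‖(N : ℂ) + w‖ ^ 2 = (N + w.re) ^ 2 + w.im ^ 2 := by
    rw [← Complex.normSq_eq_norm_sq, Complex.normSq_apply]
    simp
    ring
  have h12 : ‖w‖ ^ 2 = w.re ^ 2 + w.im ^ 2 := by
    rw [← Complex.normSq_eq_norm_sq, Complex.normSq_apply]
    ring
  have h13 : ‖w‖ ^ 2 ≤ (β - N) ^ 2 := by gcongr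
  have h14 : β ^ 2 ≤ ‖(N : ℂ) + w‖ ^ 2 := by gcongr
  -- Expanding `|N + w|² ≥ β²` and using `|w| ≤ β - N` leaves `2N·Re w ≥ 2N(β - N)`; here `N ≥ 1`
  -- allows cancellation.
  have h15 : β - N ≤ w.re := by nlinarith
  have h16 : w.im = 0 := by nlinarith [sq_nonneg w.im]
  have h17 : w.re = β - N := le_antisymm ((Complex.re_le_norm w).trans h9) h15
  have h18 : (N : ℂ) + w = β := by
    apply Complex.ext <;> simp [h16, h17]
  rwa [h18] at h8


/-! ### Norm estimates and step functions in `BV` -/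

/-- The variation of a function of bounded variation, as a real number. -/
def bvVar (f : BV) : ℝ := (eVariationOn (f : I → ℂ) Set.univ).toReal

theorem norm_sub_le_bvVar (f : BV) (x y : I) :
    ‖(f : I → ℂ) x - (f : I → ℂ) y‖ ≤ bvVar f := by
  rw [← dist_eq_norm]
  exact BoundedVariationOn.dist_le f.2 (Set.mem_univ x) (Set.mem_univ y)

theorem norm_le_bvVar_add (f : BV) (x y : I) :
    ‖(f : I → ℂ) x‖ ≤ bvVar f + ‖(f : I → ℂ) y‖ := by
  have h := norm_sub_le_bvVar f x y
  have h' := norm_sub_norm_le ((f : I → ℂ) x) ((f : I → ℂ) y)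
  linarith

theorem norm_le_bvNorm (f : BV) (x : I) : ‖(f : I → ℂ) x‖ ≤ bvNorm f := by
  have hb : BddAbove (Set.range fun x : I => ‖(f : I → ℂ) x‖) :=
    ⟨_, by rintro _ ⟨y, rfl⟩; exact norm_le_bvVar_add f y 1⟩
  exact (le_ciSup hb x).trans (le_add_of_nonneg_left ENNReal.toReal_nonneg)

theorem bvNorm_nonneg (f : BV) : 0 ≤ bvNorm f := (norm_nonneg _).trans (norm_le_bvNorm f 1)

theorem bvNorm_le (f : BV) (x : I) : bvNorm f ≤ 2 * bvVar f + ‖(f : I → ℂ) x‖ := by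
  have : ⨆ y : I, ‖(f : I → ℂ) y‖ ≤ bvVar f + ‖(f : I → ℂ) x‖ :=
    ciSup_le fun y => norm_le_bvVar_add f y x
  calc bvNorm f ≤ bvVar f + (bvVar f + ‖(f : I → ℂ) x‖) := add_le_add le_rfl this
    _ = _ := by ring

theorem hatNorm_toHat_le (f : BV) : hatNorm (toHat f) ≤ bvNorm f :=
  ciInf_le (f := fun g : {g : BV // toHat g = toHat f} => bvNorm g.1)
    ⟨0, by rintro _ ⟨g, rfl⟩; exact bvNorm_nonneg g.1⟩ ⟨f, rfl⟩

theorem IsBoundedFunctional.exists_le_bvNorm {ν : Module.Dual ℂ BVhat}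
    (h : IsBoundedFunctional ν) : ∃ C : ℝ, 0 ≤ C ∧ ∀ f : BV, ‖ν (toHat f)‖ ≤ C * bvNorm f := by
  obtain ⟨C, hC⟩ := h
  refine ⟨max C 0, le_max_right _ _, fun f => (hC _).trans ?_⟩
  refine mul_le_mul (le_max_left _ _) (hatNorm_toHat_le f) ?_ (le_max_right _ _)
  exact Real.iInf_nonneg fun g => bvNorm_nonneg g.1

theorem isBoundedFunctional_of_le_bvNorm {ν : Module.Dual ℂ BVhat} {C : ℝ} (hC0 : 0 ≤ C)
    (hC : ∀ f : BV, ‖ν (toHat f)‖ ≤ C * bvNorm f) : IsBoundedFunctional ν := by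
  refine ⟨C, fun F => ?_⟩
  obtain ⟨f, rfl⟩ := nullBV.mkQ_surjective F
  have : Nonempty {g : BV // toHat g = nullBV.mkQ f} := ⟨⟨f, rfl⟩⟩
  rw [hatNorm, Real.mul_iInf_of_nonneg hC0]
  refine le_ciInf fun g => ?_
  have h := hC g.1
  rwa [g.2] at h

/-- The indicator function of `[0,y)`. -/
def stepBV (y : ℝ) : BV :=
  ⟨Set.indicator {x : I | (x : ℝ) < y} fun _ => (1 : ℂ),
    bv_indicator_lower fun a b (hxy : (b : ℝ) ≤ a) (hx : (a : ℝ) < y) => lt_of_le_of_lt hxy hx⟩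

theorem stepBV_apply (y : ℝ) (x : I) :
    (stepBV y : I → ℂ) x = if (x : ℝ) < y then 1 else 0 := by
  simp [stepBV, Set.indicator_apply]

theorem bvNorm_stepBV_le (y : ℝ) : bvNorm (stepBV y) ≤ 3 := by
  have hm : MonotoneOn (fun x : I => if (x : ℝ) < y then (0 : ℝ) else 1) Set.univ := by
    intro a _ b _ (hab : (a : ℝ) ≤ b)
    by_cases hb : (b : ℝ) < y
    · simp [hb, lt_of_le_of_lt hab hb]
    · by_cases ha : (a : ℝ) < y <;> simp [ha, hb]
  have hL : LipschitzWith 1 (fun t : ℝ => (1 : ℂ) - (t : ℂ)) := by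
    refine LipschitzWith.of_dist_le_mul fun a b => ?_
    rw [dist_sub_left, NNReal.coe_one, one_mul, Complex.dist_of_im_eq (by simp)]
    simp
  have hcomp : (stepBV y : I → ℂ) =
      (fun t : ℝ => (1 : ℂ) - (t : ℂ)) ∘ fun x : I => if (x : ℝ) < y then (0 : ℝ) else 1 := by
    funext x
    rw [stepBV_apply]
    by_cases hx : (x : ℝ) < y <;> simp [hx]
  have hv : eVariationOn (stepBV y : I → ℂ) Set.univ ≤ ENNReal.ofReal 1 := by
    rw [hcomp]
    refine (hL.lipschitzOnWith.comp_eVariationOn_le (Set.mapsTo_univ _ _)).trans ?_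
    rw [ENNReal.coe_one, one_mul]
    have h := (hm.eVariationOn_eq (Set.mem_univ 0) (Set.mem_univ 1)).le
    have huniv : Set.univ ∩ Set.Icc (0 : I) 1 = Set.univ := by
      rw [Set.univ_inter]
      exact Set.eq_univ_of_forall fun x => ⟨x.2.1, x.2.2⟩
    rw [huniv] at h
    refine h.trans (ENNReal.ofReal_le_ofReal ?_)
    split_ifs <;> norm_num
  have hv' : bvVar (stepBV y) ≤ 1 := ENNReal.toReal_le_of_le_ofReal zero_le_one hv
  have h1 : ‖(stepBV y : I → ℂ) 1‖ ≤ 1 := by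
    rw [stepBV_apply]
    split_ifs <;> simp
  linarith [bvNorm_le (stepBV y) 1]

/-- The constant function `1`. -/
def oneBV : BV := ⟨fun _ => 1, bv_const 1⟩

theorem toHat_eq_of_countable {f g : BV} {s : Set I} (hs : s.Countable)
    (h : ∀ x ∉ s, (f : I → ℂ) x = (g : I → ℂ) x) : toHat f = toHat g := by
  refine (Submodule.Quotient.eq nullBV).2 (hs.mono fun x hx => ?_)
  by_contra hxs
  exact hx (by simp [h x hxs])

theorem toHat_stepBV_of_nonpos {y : ℝ} (hy : y ≤ 0) : toHat (stepBV y) = 0 := by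
  have : stepBV y = 0 := by
    apply Subtype.ext
    funext x
    rw [stepBV_apply, if_neg (not_lt.2 (hy.trans x.2.1))]
    rfl
  rw [this]
  exact map_zero nullBV.mkQ

theorem toHat_stepBV_of_one_le {y : ℝ} (hy : 1 ≤ y) : toHat (stepBV y) = toHat oneBV := by
  refine toHat_eq_of_countable (Set.countable_singleton (1 : I)) fun x hx => ?_
  have : (x : ℝ) < 1 := lt_of_le_of_ne x.2.2 fun h => hx (Subtype.ext h)
  rw [stepBV_apply, if_pos (this.trans_le hy)]
  rfl

theorem transferHat_toHat {β : ℝ} (hβ : 1 < β) (f : BV) :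
    transferHat β hβ (toHat f) = toHat (transferBV β hβ f) := rfl

theorem countable_coe_mem_finset (s : Finset ℝ) : {x : I | (x : ℝ) ∈ s}.Countable :=
  (s.countable_toSet.preimage_of_injOn Subtype.val_injective.injOn)

/-! ### Distribution functions of eigenfunctionals -/

/-- Branch `i` sends `x` into `[0,y)` exactly when `x < βy - i`. Since `y ≤ 1`, this already puts `x
≠ 1` in the domain of the branch; no branch is defined at `1`. -/
theorem transferHat_stepBV {β : ℝ} (hβ : 1 < β) {y : ℝ} (hy : y ≤ 1) :
    transferHat β hβ (toHat (stepBV y)) =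
      (β : ℂ)⁻¹ • ∑ i ∈ Finset.range (⌊β⌋₊ + 1), toHat (stepBV (β * y - i)) := by
  classical
  have h0 : 0 < β := by linarith
  rw [transferHat_toHat, ← map_sum, ← map_smul]
  refine toHat_eq_of_countable (Set.countable_singleton (1 : I)) fun x hx => ?_
  have hx1 : (x : ℝ) < 1 := lt_of_le_of_ne x.2.2 fun h => hx (Subtype.ext h)
  show transfer β (stepBV y : I → ℂ) x = _
  rw [transfer_eq_sum hβ]
  simp only [Submodule.coe_smul, Pi.smul_apply, smul_eq_mul, AddSubmonoidClass.coe_finsetSum,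
    Finset.sum_apply]
  congr 1
  refine Finset.sum_congr rfl fun i _ => ?_
  rw [stepBV_apply, stepBV_apply]
  have hyβ : β * y ≤ β := mul_le_of_le_one_right h0.le hy
  by_cases hd : x ∈ branchDomain β i
  · rw [if_pos hd, branch_coe hβ hd]
    congr 1
    rw [div_lt_iff₀ h0, lt_sub_iff_add_lt, mul_comm y β]
  · have : ¬ (x : ℝ) < β * y - i := fun h => hd ⟨hx1, by linarith⟩
    rw [if_neg hd, if_neg this]

/-- The distribution function of an eigenfunctional is self-similar. -/
theorem isSelfSimilar_of_eigen {β : ℝ} (hβ : 1 < β) {lam : ℂ} (hlam : lam ≠ 0)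
    {ν : Module.Dual ℂ BVhat} (hν : ∀ F, ν (transferHat β hβ F) = lam * ν F) :
    IsSelfSimilar β (β * lam)⁻¹ fun y => ν (toHat (stepBV y)) := by
  have h0 : 0 < β := by linarith
  refine ⟨by simp [toHat_stepBV_of_nonpos le_rfl], fun i y hy hi hi' => ?_⟩
  have h1 := hν (toHat (stepBV y))
  rw [transferHat_stepBV hβ hy, map_smul, map_sum] at h1
  have hile : i ≤ ⌊β⌋₊ := Nat.le_floor (hi.trans (mul_le_of_le_one_right h0.le hy))
  have h2 : ∑ j ∈ Finset.range (⌊β⌋₊ + 1), ν (toHat (stepBV (β * y - j))) =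
      i * ν (toHat (stepBV 1)) + ν (toHat (stepBV (β * y - i))) := by
    -- Branches below `i` contribute the full interval, branch `i` a partial one, and later branches
    -- nothing.
    rw [← Finset.sum_range_add_sum_Ico _ (Nat.succ_le_succ hile), Finset.sum_range_succ,
      Finset.sum_congr (g := fun _ => ν (toHat (stepBV 1))) rfl,
      Finset.sum_eq_zero (s := Finset.Ico _ _)]
    · simp
    · intro j hj
      have : ((i + 1 : ℕ) : ℝ) ≤ j := by exact_mod_cast (Finset.mem_Ico.1 hj).1
      push_cast at this
      rw [toHat_stepBV_of_nonpos (by linarith), map_zero]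
    · intro j hj
      have : ((j + 1 : ℕ) : ℝ) ≤ i := by exact_mod_cast Finset.mem_range.1 hj
      push_cast at this
      rw [toHat_stepBV_of_one_le (by linarith), toHat_stepBV_of_one_le le_rfl]
  rw [h2, smul_eq_mul] at h1
  have h3 : (β : ℂ) ≠ 0 := by exact_mod_cast h0.ne'
  show ν (toHat (stepBV y)) = _
  rw [mul_inv, mul_comm (β : ℂ)⁻¹, mul_assoc, h1, inv_mul_cancel_left₀ hlam]

/-! ### Branch sums and uniqueness of bounded eigenfunctionals -/

theorem branch_monotone {β : ℝ} (hβ : 1 < β) (i : ℕ) : Monotone (branch β i) := by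
  intro x y hxy
  have hxy' : (x : ℝ) ≤ y := hxy
  refine Set.monotone_projIcc _ ?_
  gcongr

theorem eVariationOn_add_le (f g : I → ℂ) : eVariationOn (f + g) Set.univ ≤
    eVariationOn f Set.univ + eVariationOn g Set.univ := by
  refine iSup_le fun p => ?_
  refine le_trans ?_ (add_le_add (eVariationOn.sum_le (f := f) (n := p.1) p.2.2.1 p.2.2.2)
    (eVariationOn.sum_le (f := g) (n := p.1) p.2.2.1 p.2.2.2))
  rw [← Finset.sum_add_distrib]
  exact Finset.sum_le_sum fun i _ => edist_add_add_le _ _ _ _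

theorem eVariationOn_sum_le {ι : Type*} (s : Finset ι) (g : ι → I → ℂ) :
    eVariationOn (∑ i ∈ s, g i) Set.univ ≤ ∑ i ∈ s, eVariationOn (g i) Set.univ := by
  classical
  induction s using Finset.induction_on with
  | empty =>
    simp only [Finset.sum_empty]
    refine (eVariationOn.constant_on (f := (0 : I → ℂ)) ?_).le
    rintro _ ⟨_, _, rfl⟩ _ ⟨_, _, rfl⟩
    rfl
  | insert a s ha ih =>
    rw [Finset.sum_insert ha, Finset.sum_insert ha]
    exact (eVariationOn_add_le _ _).trans (by gcongr)

/-- The sum of a function over all inverse branches, each extended to `[0,1]` by a constant. -/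
def branchSum (β : ℝ) (f : I → ℂ) : I → ℂ :=
  ∑ i ∈ Finset.range (⌊β⌋₊ + 1), f ∘ branch β i

/-- The truncated branches take values in consecutive, non-overlapping intervals, so the variations
of the pieces add up to at most that of `f`. -/
theorem eVariationOn_branchSum_le {β : ℝ} (hβ : 1 < β) (f : I → ℂ) :
    eVariationOn (branchSum β f) Set.univ ≤ eVariationOn f Set.univ := by
  have h0 : 0 < β := by linarith
  set p : ℕ → I := fun i => Set.projIcc 0 1 zero_le_one ((i : ℝ) / β)
  have hp : Monotone p := fun i j hij => Set.monotone_projIcc _ (by gcongr)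
  calc eVariationOn (branchSum β f) Set.univ
      ≤ ∑ i ∈ Finset.range (⌊β⌋₊ + 1), eVariationOn (f ∘ branch β i) Set.univ :=
        eVariationOn_sum_le _ _
    _ ≤ ∑ i ∈ Finset.range (⌊β⌋₊ + 1), eVariationOn f (Set.Icc (p i) (p (i + 1))) := by
        refine Finset.sum_le_sum fun i _ => ?_
        refine eVariationOn.comp_le_of_monotoneOn f _ ((branch_monotone hβ i).monotoneOn _) ?_
        intro x _
        refine ⟨Set.monotone_projIcc _ ?_, Set.monotone_projIcc _ ?_⟩
        · have := x.2.1
          gcongr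
          linarith
        · have := x.2.2
          push_cast
          rw [add_comm]
          gcongr
    _ = eVariationOn f (Set.Icc (p 0) (p (⌊β⌋₊ + 1))) := eVariationOn.sum' f hp
    _ ≤ eVariationOn f Set.univ := eVariationOn.mono f (Set.subset_univ _)

/-- `branchSum` as a map of functions of bounded variation. -/
def branchSumBV {β : ℝ} (hβ : 1 < β) (f : BV) : BV :=
  ⟨branchSum β f, ne_top_of_le_ne_top f.2 (eVariationOn_branchSum_le hβ f)⟩

/-- Modulo step functions, the transfer operator is `branchSum` divided by `β`. -/
theorem transferHat_eq_branchSum {β : ℝ} (hβ : 1 < β) (f : BV) :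
    transferHat β hβ (toHat f) = (β : ℂ)⁻¹ • (toHat (branchSumBV hβ f) -
      ∑ i ∈ Finset.range (⌊β⌋₊ + 1),
        (f : I → ℂ) 1 • (toHat oneBV - toHat (stepBV (β - i)))) := by
  classical
  have h0 : 0 < β := by linarith
  simp only [transferHat_toHat, ← map_sub, ← map_smul, ← map_sum]
  -- The exceptional points are `1`, where no branch is defined, and the endpoints `β - i`, which
  -- belong to the branch domain but not to the half-open step.
  refine toHat_eq_of_countable (countable_coe_mem_finset
    (insert 1 ((Finset.range (⌊β⌋₊ + 1)).image fun i : ℕ => β - i))) fun x hx => ?_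
  simp only [Set.mem_ofPred_eq, Finset.mem_insert, Finset.mem_image, not_or, not_exists,
    not_and] at hx
  have hx1 : (x : ℝ) < 1 := lt_of_le_of_ne x.2.2 hx.1
  show transfer β (f : I → ℂ) x = (β : ℂ)⁻¹ * ((branchSum β f : I → ℂ) x - _)
  rw [transfer_eq_sum hβ]
  simp only [branchSum, Submodule.coe_smul, Submodule.coe_sub, Pi.smul_apply, smul_eq_mul,
    AddSubmonoidClass.coe_finsetSum, Finset.sum_apply, Function.comp_apply, Pi.sub_apply]
  rw [← Finset.sum_sub_distrib]
  congr 1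
  refine Finset.sum_congr rfl fun i hi => ?_
  have hone : (oneBV : I → ℂ) x = 1 := rfl
  rw [stepBV_apply, hone]
  have hne : β - i ≠ x := hx.2 i hi
  by_cases hd : (x : ℝ) < β - i
  · rw [if_pos hd, if_pos (show x ∈ branchDomain β i from ⟨hx1, by linarith⟩)]
    simp
  · rw [if_neg hd, if_neg (show x ∉ branchDomain β i from
      fun h => hd (lt_of_le_of_ne (by linarith [h.2]) hne.symm))]
    -- Beyond its domain the truncated branch is constantly `1`, which is why the correction carries
    -- the coefficient `f 1`.
    have hb : branch β i x = 1 := by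
      refine Set.projIcc_of_right_le _ ?_
      rw [le_div_iff₀ h0]
      linarith
    rw [hb]
    simp

/-- A bounded eigenfunctional for an eigenvalue of modulus greater than `1/β` is determined by
its value on the constant function `1`. -/
theorem eq_zero_of_eigen {β : ℝ} (hβ : 1 < β) {lam : ℂ} (hlam : 1 / β < ‖lam‖)
    {ν : Module.Dual ℂ BVhat} (hν : ∀ F, ν (transferHat β hβ F) = lam * ν F)
    {C : ℝ} (hC0 : 0 ≤ C) (hC : ∀ f : BV, ‖ν (toHat f)‖ ≤ C * bvNorm f)
    (h1 : ν (toHat oneBV) = 0) : ν = 0 := by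
  have h0 : 0 < β := by linarith
  have hlam0 : lam ≠ 0 := by
    rintro rfl
    rw [norm_zero] at hlam
    exact absurd hlam (not_lt.2 (by positivity))
  have hκ : ‖((β : ℂ) * lam)⁻¹‖ < 1 := by
    rw [norm_inv, norm_mul, Complex.norm_real, Real.norm_of_nonneg h0.le]
    refine inv_lt_one_of_one_lt₀ ?_
    rwa [div_lt_iff₀' h0] at hlam
  have hstep : ∀ y, ν (toHat (stepBV y)) = 0 := by
    intro y
    rcases le_total y 0 with hy | hy
    · rw [toHat_stepBV_of_nonpos hy, map_zero]
    rcases le_total 1 y with hy' | hy'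
    · rw [toHat_stepBV_of_one_le hy', h1]
    · refine (isSelfSimilar_of_eigen hβ hlam0 hν).eq_zero hβ hκ (B := C * 3)
        (fun y => (hC _).trans (by gcongr; exact bvNorm_stepBV_le y)) ?_ y ⟨hy, hy'⟩
      rw [toHat_stepBV_of_one_le le_rfl, h1]
  have hrec : ∀ f : BV, ν (toHat f) = (β * lam)⁻¹ * ν (toHat (branchSumBV hβ f)) := by
    intro f
    have h := hν (toHat f)
    rw [transferHat_eq_branchSum hβ f, map_smul, map_sub, map_sum,
      Finset.sum_eq_zero fun i _ => by rw [map_smul, map_sub, h1, hstep, sub_zero, smul_zero],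
      sub_zero, smul_eq_mul] at h
    rw [mul_inv, mul_comm (β : ℂ)⁻¹, mul_assoc, h, inv_mul_cancel_left₀ hlam0]
  -- As `ν` kills constants, `f` may be normalised to vanish at `1`, so that its norm is controlled
  -- by its variation alone.
  have hbd : ∀ f : BV, ‖ν (toHat f)‖ ≤ C * (2 * bvVar f) := by
    intro f
    set c : ℂ := (f : I → ℂ) 1
    set g : BV := f - c • oneBV with hg
    have hνg : ν (toHat g) = ν (toHat f) := by
      have : toHat g = toHat f - c • toHat oneBV := rfl
      rw [this, map_sub, map_smul, h1, smul_zero, sub_zero]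
    have hg1 : (g : I → ℂ) 1 = 0 := by simp [hg, oneBV, c]
    have hgv : bvVar g ≤ bvVar f := by
      refine ENNReal.toReal_mono f.2 ?_
      refine iSup_le fun p => le_trans (le_of_eq ?_)
        (eVariationOn.sum_le (f := (f : I → ℂ)) (n := p.1) p.2.2.1 p.2.2.2)
      refine Finset.sum_congr rfl fun i _ => ?_
      simp [hg, oneBV, edist_dist]
    have := bvNorm_le g 1
    rw [hg1, norm_zero, add_zero] at this
    rw [← hνg]
    exact (hC g).trans (by gcongr; linarith)
  refine LinearMap.ext fun F => ?_
  obtain ⟨f, rfl⟩ := nullBV.mkQ_surjective F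
  -- This set is stable under `branchSumBV`, and `ν` is uniformly bounded on it.
  have := nonneg_of_contraction (s := {g : BV | bvVar g ≤ bvVar f})
    (G := fun g => -‖ν (toHat g)‖) (norm_nonneg _) hκ (B := C * (2 * bvVar f))
    (fun g hg => by
      refine neg_le_neg ((hbd g).trans ?_)
      have : bvVar g ≤ bvVar f := hg
      gcongr)
    (fun g hg => by
      refine ⟨branchSumBV hβ g, ?_, ?_⟩
      · exact (ENNReal.toReal_mono g.2 (eVariationOn_branchSum_le hβ _)).trans hg
      · rw [hrec g, norm_mul, mul_neg]) f (le_refl (bvVar f))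
  exact norm_le_zero_iff.1 (neg_nonneg.1 this)


/-! ### The Lebesgue integral as an invariant functional -/

theorem measurable_of_boundedVariationOn {f : I → ℝ} (hf : BoundedVariationOn f Set.univ) :
    Measurable f := by
  obtain ⟨p, q, hp, hq, rfl⟩ :=
    hf.locallyBoundedVariationOn.exists_monotoneOn_sub_monotoneOn
  exact (monotoneOn_univ.1 hp).measurable.sub (monotoneOn_univ.1 hq).measurable

theorem measurable_coe_bv (f : BV) : Measurable (f : I → ℂ) := by
  have hre : LipschitzWith 1 Complex.re := by
    refine LipschitzWith.of_dist_le_mul fun a b => ?_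
    rw [NNReal.coe_one, one_mul, Real.dist_eq, ← Complex.sub_re, Complex.dist_eq]
    exact Complex.abs_re_le_norm _
  have him : LipschitzWith 1 Complex.im := by
    refine LipschitzWith.of_dist_le_mul fun a b => ?_
    rw [NNReal.coe_one, one_mul, Real.dist_eq, ← Complex.sub_im, Complex.dist_eq]
    exact Complex.abs_im_le_norm _
  have h1 := measurable_of_boundedVariationOn (hre.comp_boundedVariationOn f.2)
  have h2 := measurable_of_boundedVariationOn (him.comp_boundedVariationOn f.2)
  have : (f : I → ℂ) = fun x => ((Complex.re ∘ (f : I → ℂ)) x : ℂ) +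
      ((Complex.im ∘ (f : I → ℂ)) x : ℂ) * Complex.I := by
    funext x
    simp
  rw [this]
  exact (Complex.measurable_ofReal.comp h1).add
    ((Complex.measurable_ofReal.comp h2).mul_const _)

theorem integrable_coe_bv (f : BV) : Integrable (f : I → ℂ) volume :=
  Integrable.of_bound (measurable_coe_bv f).aestronglyMeasurable (bvNorm f)
    (Filter.Eventually.of_forall fun x => norm_le_bvNorm f x)

/-- The Lebesgue integral as a functional on `BV`. -/
def integralBV : BV →ₗ[ℂ] ℂ where
  toFun f := ∫ x : I, (f : I → ℂ) x ∂volume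
  map_add' f g := integral_add (integrable_coe_bv f) (integrable_coe_bv g)
  map_smul' c _ := integral_const_mul c _

theorem volume_countable_eq_zero {s : Set I} (hs : s.Countable) : (volume : Measure I) s = 0 := by
  show Measure.comap _ _ s = 0
  rw [(MeasurableEmbedding.subtype_coe measurableSet_Icc).comap_apply]
  exact (hs.image _).measure_zero _

theorem nullBV_le_ker_integralBV : nullBV ≤ LinearMap.ker integralBV := by
  intro f hf
  refine integral_eq_zero_of_ae ?_
  exact volume_countable_eq_zero hf

/-- The Lebesgue integral as a functional on `BVhat`. -/
def integralHat : Module.Dual ℂ BVhat := nullBV.liftQ integralBV nullBV_le_ker_integralBV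

theorem integralHat_toHat (f : BV) : integralHat (toHat f) = ∫ x : I, (f : I → ℂ) x ∂volume := rfl

theorem norm_integralHat_le (f : BV) : ‖integralHat (toHat f)‖ ≤ 1 * bvNorm f := by
  rw [integralHat_toHat]
  have h := norm_integral_le_of_norm_le_const (μ := (volume : Measure I))
    (Filter.Eventually.of_forall fun x => norm_le_bvNorm f x)
  have : (volume : Measure I).real Set.univ = 1 := by simp
  rwa [this, mul_one, ← one_mul (bvNorm f)] at h

theorem integralHat_oneBV : integralHat (toHat oneBV) = 1 := by
  rw [integralHat_toHat]
  simp [oneBV]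

/-- The extension of a function on `[0,1]` by zero. -/
def zeroExtend (f : I → ℂ) (t : ℝ) : ℂ :=
  (Set.Icc (0 : ℝ) 1).indicator (fun t => f (Set.projIcc 0 1 zero_le_one t)) t

theorem zeroExtend_coe (f : I → ℂ) (x : I) : zeroExtend f x = f x := by
  rw [zeroExtend, Set.indicator_of_mem x.2, Set.projIcc_val]

theorem integral_eq_intervalIntegral (f : I → ℂ) :
    ∫ x : I, f x = ∫ t in (0 : ℝ)..1, zeroExtend f t := by
  rw [intervalIntegral.integral_of_le zero_le_one, ← integral_Icc_eq_integral_Ioc,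
    ← integral_subtype measurableSet_Icc]
  simp only [zeroExtend_coe]

theorem integrable_zeroExtend (f : BV) : Integrable (zeroExtend (f : I → ℂ)) := by
  refine (integrable_indicator_iff measurableSet_Icc).2 ?_
  refine Measure.integrableOn_of_bounded (M := bvNorm f) (by simp)
    ((measurable_coe_bv f).comp continuous_projIcc.measurable).aestronglyMeasurable ?_
  exact Filter.Eventually.of_forall fun x => norm_le_bvNorm f _

theorem zeroExtend_transfer {β : ℝ} (hβ : 1 < β) (f : I → ℂ) {t : ℝ} (ht0 : 0 ≤ t) (ht1 : t < 1) :
    zeroExtend (transfer β f) t =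
      (β : ℂ)⁻¹ * ∑ i ∈ Finset.range (⌊β⌋₊ + 1), zeroExtend f (t / β + i / β) := by
  classical
  have h0 : 0 < β := by linarith
  lift t to I using ⟨ht0, ht1.le⟩
  rw [zeroExtend_coe, transfer_eq_sum hβ]
  congr 1
  refine Finset.sum_congr rfl fun i _ => ?_
  rw [← add_div]
  by_cases hd : t ∈ branchDomain β i
  · rw [if_pos hd, ← branch_coe hβ hd, zeroExtend_coe]
  · rw [if_neg hd, zeroExtend, Set.indicator_of_notMem]
    intro h
    exact hd ⟨ht1, (div_le_one h0).1 h.2⟩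

/-- The transfer operator preserves the Lebesgue integral. -/
theorem integralHat_transferHat {β : ℝ} (hβ : 1 < β) (F : BVhat) :
    integralHat (transferHat β hβ F) = integralHat F := by
  have h0 : 0 < β := by linarith
  have h0' : (β : ℂ) ≠ 0 := by exact_mod_cast h0.ne'
  obtain ⟨f, rfl⟩ := nullBV.mkQ_surjective F
  show ∫ x : I, transfer β (f : I → ℂ) x = ∫ x : I, (f : I → ℂ) x
  rw [integral_eq_intervalIntegral, integral_eq_intervalIntegral]
  set h : ℝ → ℂ := zeroExtend (f : I → ℂ) with hh
  have hint : Integrable h := integrable_zeroExtend f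
  have h1 : ∫ t in (0 : ℝ)..1, zeroExtend (transfer β (f : I → ℂ)) t =
      ∫ t in (0 : ℝ)..1, (β : ℂ)⁻¹ * ∑ i ∈ Finset.range (⌊β⌋₊ + 1), h (t / β + i / β) := by
    -- The branch formula for the zero extension is only available for `t < 1`, hence the open
    -- interval.
    rw [intervalIntegral.integral_of_le zero_le_one, intervalIntegral.integral_of_le zero_le_one,
      integral_Ioc_eq_integral_Ioo, integral_Ioc_eq_integral_Ioo]
    exact setIntegral_congr_fun measurableSet_Ioo fun t ht =>
      zeroExtend_transfer hβ _ ht.1.le ht.2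
  have h2 : ∀ i : ℕ, ∫ t in (0 : ℝ)..1, h (t / β + i / β) =
      β * ∫ t in (i / β : ℝ)..((i + 1 : ℕ) / β : ℝ), h t := by
    intro i
    rw [intervalIntegral.integral_comp_div_add h h0.ne', zero_div, zero_add, ← add_div,
      Complex.real_smul]
    push_cast
    rw [add_comm]
  -- The last branch interval may overshoot `1`; the zero extension contributes nothing there.
  have h3 : 1 ≤ ((⌊β⌋₊ + 1 : ℕ) / β : ℝ) := by
    rw [le_div_iff₀ h0, one_mul]
    push_cast
    exact (Nat.lt_floor_add_one β).le
  have h4 : ∫ t in (1 : ℝ)..((⌊β⌋₊ + 1 : ℕ) / β : ℝ), h t = 0 := by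
    rw [intervalIntegral.integral_of_le h3]
    refine setIntegral_eq_zero_of_forall_eq_zero fun t ht => ?_
    rw [hh, zeroExtend, Set.indicator_of_notMem]
    exact fun h => absurd h.2 (not_le.2 ht.1)
  rw [h1, intervalIntegral.integral_const_mul, intervalIntegral.integral_finsetSum]
  · simp only [h2]
    rw [← Finset.mul_sum, inv_mul_cancel_left₀ h0',
      intervalIntegral.sum_integral_adjacent_intervals (a := fun i : ℕ => (i / β : ℝ))
        fun _ _ => hint.intervalIntegrable]
    rw [← intervalIntegral.integral_add_adjacent_intervals (b := 1) hint.intervalIntegrable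
      hint.intervalIntegrable, h4, add_zero]
    simp
  · intro i _
    refine Integrable.intervalIntegrable ?_
    exact (hint.comp_add_right (i / β)).comp_div h0.ne'

/-! ### Functionals given by complex measures -/

instance (m : ComplexMeasure I) : IsFiniteMeasure m.variation := by
  have hle : m.variation ≤ m.re.totalVariation + m.im.totalVariation := by
    refine VectorMeasure.variation_le_of_forall_enorm_le fun s hs => ?_
    rw [Measure.add_apply]
    refine le_trans ?_ (add_le_add (m.re.enorm_le_totalVariation s)
      (m.im.enorm_le_totalVariation s))
    have h : m s = ((m s).re : ℂ) + (m s).im * Complex.I := (Complex.re_add_im _).symm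
    calc ‖m s‖ₑ = ‖((m s).re : ℂ) + (m s).im * Complex.I‖ₑ := by rw [← h]
      _ ≤ ‖((m s).re : ℂ)‖ₑ + ‖((m s).im : ℂ) * Complex.I‖ₑ := enorm_add_le _ _
      _ = ‖(m s).re‖ₑ + ‖(m s).im‖ₑ := by
        rw [enorm_mul]
        simp [enorm_eq_nnnorm]
  exact isFiniteMeasure_of_le _ hle

theorem norm_complexIntegral_le (m : ComplexMeasure I) (f : BV) :
    ‖complexIntegral m f‖ ≤
      (‖ContinuousLinearMap.mul ℝ ℂ‖ * m.variation.real Set.univ) * bvNorm f := by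
  refine (VectorMeasure.norm_integral_le_of_norm_le_const
    (Filter.Eventually.of_forall fun x => norm_le_bvNorm f x)).trans (le_of_eq ?_)
  ring

theorem measurableSet_coe_lt (y : ℝ) : MeasurableSet {x : I | (x : ℝ) < y} :=
  measurableSet_lt measurable_subtype_coe measurable_const

theorem complexIntegral_stepBV (m : ComplexMeasure I) (y : ℝ) :
    complexIntegral m (stepBV y) = m {x : I | (x : ℝ) < y} := by
  have := VectorMeasure.integral_indicator_const (μ := m) (B := ContinuousLinearMap.mul ℝ ℂ)
    (1 : ℂ) (measurableSet_coe_lt y)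
  rw [ContinuousLinearMap.mul_apply', one_mul] at this
  exact this

/-- The distribution function of a complex measure has bounded variation. -/
theorem boundedVariationOn_distribution (m : ComplexMeasure I) :
    BoundedVariationOn (fun y : ℝ => m {x : I | (x : ℝ) < y}) Set.univ := by
  -- The increments of the distribution function are dominated by those of this bounded monotone
  -- function.
  set G : ℝ → ℝ := fun y => m.variation.real {x : I | (x : ℝ) < y}
  have hG : Monotone G := fun a b hab =>
    measureReal_mono fun x (hx : (x : ℝ) < a) => lt_of_lt_of_le hx hab
  have hGb : BoundedVariationOn G Set.univ :=
    (hG.monotoneOn _).boundedVariationOn (C := m.variation.real Set.univ) fun y _ => by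
      rw [abs_of_nonneg measureReal_nonneg]
      exact measureReal_mono (Set.subset_univ _)
  refine ne_top_of_le_ne_top hGb (iSup_le fun p => le_trans (Finset.sum_le_sum fun i _ => ?_)
    (eVariationOn.sum_le (f := G) (n := p.1) p.2.2.1 p.2.2.2))
  have hle : p.2.1 i ≤ p.2.1 (i + 1) := p.2.2.1 (Nat.le_succ i)
  have hsub : {x : I | (x : ℝ) < p.2.1 i} ⊆ {x : I | (x : ℝ) < p.2.1 (i + 1)} :=
    fun x (hx : (x : ℝ) < _) => lt_of_lt_of_le hx hle
  rw [edist_dist, edist_dist]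
  refine ENNReal.ofReal_le_ofReal ?_
  have hm := VectorMeasure.of_sdiff (v := m) (measurableSet_coe_lt (p.2.1 i))
    (measurableSet_coe_lt (p.2.1 (i + 1))) hsub
  have hμ := measureReal_sdiff (μ := m.variation) hsub (measurableSet_coe_lt (p.2.1 i))
  rw [dist_eq_norm, Real.dist_eq, abs_of_nonneg (sub_nonneg.2 (hG hle)), ← hm, ← hμ]
  exact VectorMeasure.norm_measure_le_variation

/-! ### The two halves of the theorem -/

theorem eigen_apply {β : ℝ} {hβ : 1 < β} {lam : ℂ} {ν : Module.Dual ℂ BVhat}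
    (h : IsEigenfunctional β hβ lam ν) (F : BVhat) : ν (transferHat β hβ F) = lam * ν F :=
  LinearMap.congr_fun (Module.End.HasEigenvector.apply_eq_smul h) F

/-- An eigenfunctional given by a complex measure, for an eigenvalue of modulus greater than
`1/β`, belongs to the eigenvalue `1`. -/
theorem eigenvalue_eq_one_of_complexMeasure {β : ℝ} (hβ : 1 < β) {lam : ℂ} (hlam : 1 / β < ‖lam‖)
    {ν : Module.Dual ℂ BVhat} (hν : IsEigenfunctional β hβ lam ν) {m : ComplexMeasure I}
    (hm : ∀ f : BV, ν (toHat f) = complexIntegral m f) : lam = 1 := by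
  have h0 : 0 < β := by linarith
  have h0' : (β : ℂ) ≠ 0 := by exact_mod_cast h0.ne'
  have hlam0 : lam ≠ 0 := by
    rintro rfl
    rw [norm_zero] at hlam
    exact absurd hlam (not_lt.2 (by positivity))
  have hC : ∀ f : BV, ‖ν (toHat f)‖ ≤ _ := fun f => (hm f).symm ▸ norm_complexIntegral_le m f
  have hF : (fun y => ν (toHat (stepBV y))) = fun y : ℝ => m {x : I | (x : ℝ) < y} :=
    funext fun y => by rw [hm, complexIntegral_stepBV]
  have h1 : ν (toHat (stepBV 1)) ≠ 0 := by
    rw [toHat_stepBV_of_one_le le_rfl]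
    intro h
    exact hν.2 (eq_zero_of_eigen hβ hlam (eigen_apply hν) (by positivity) hC h)
  have h := (isSelfSimilar_of_eigen hβ hlam0 (eigen_apply hν)).eq_inv hβ
    (hF ▸ boundedVariationOn_distribution m) h1
    fun y => (hC _).trans (mul_le_mul_of_nonneg_left (bvNorm_stepBV_le y) (by positivity))
  field_simp at h
  exact h.symm

theorem isEigenfunctional_integralHat {β : ℝ} (hβ : 1 < β) :
    IsEigenfunctional β hβ 1 integralHat := by
  refine ⟨Module.End.mem_eigenspace_iff.2 (LinearMap.ext fun F => ?_), fun h => ?_⟩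
  · rw [one_smul]
    exact integralHat_transferHat hβ F
  · have h1 := integralHat_oneBV
    rw [h] at h1
    exact zero_ne_one h1

theorem eq_smul_integralHat {β : ℝ} (hβ : 1 < β) {ν : Module.Dual ℂ BVhat}
    (hν : IsEigenfunctional β hβ 1 ν) (hb : IsBoundedFunctional ν) :
    ν = ν (toHat oneBV) • integralHat := by
  obtain ⟨C, hC0, hC⟩ := hb.exists_le_bvNorm
  set c := ν (toHat oneBV)
  -- The difference `ν - ν(1)∫` is bounded, satisfies the eigenvalue equation for `1`, and vanishes
  -- on the constant `1`.
  refine sub_eq_zero.1 (eq_zero_of_eigen hβ (lam := 1) ?_ (C := C + ‖c‖ * 1) ?_ (by positivity)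
    ?_ ?_)
  · rw [norm_one, div_lt_one (by linarith)]
    exact hβ
  · intro F
    simp only [LinearMap.sub_apply, LinearMap.smul_apply, eigen_apply hν,
      integralHat_transferHat hβ, one_mul]
  · intro f
    rw [add_mul, mul_assoc]
    refine (norm_sub_le _ _).trans (add_le_add (hC f) ?_)
    rw [LinearMap.smul_apply, norm_smul]
    exact mul_le_mul_of_nonneg_left (norm_integralHat_le f) (norm_nonneg c)
  · rw [LinearMap.sub_apply, LinearMap.smul_apply, integralHat_oneBV, smul_eq_mul, mul_one,
      sub_self]

end BetaTransfer

end

theorem theorem4p5 (β : ℝ) (hβ : 1 < β) (hβ_int : ∀ n : ℤ, β ≠ n) :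
    (∀ lam : ℂ, BetaTransfer.IsNonLeadingEigenvalue β hβ lam →
      ∀ ν : Module.Dual ℂ BetaTransfer.BVhat, BetaTransfer.IsEigenfunctional β hβ lam ν →
        ¬ ∃ m : MeasureTheory.ComplexMeasure BetaTransfer.I, ∀ f : BetaTransfer.BV,
          ν (BetaTransfer.toHat f) = BetaTransfer.complexIntegral m f) ∧
    (∃ ν : Module.Dual ℂ BetaTransfer.BVhat,
      BetaTransfer.IsEigenfunctional β hβ 1 ν ∧ BetaTransfer.IsBoundedFunctional ν ∧
      (∀ f : BetaTransfer.BV, ν (BetaTransfer.toHat f) =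
        ∫ x : BetaTransfer.I, (f : BetaTransfer.I → ℂ) x ∂MeasureTheory.volume) ∧
      ∀ ν' : Module.Dual ℂ BetaTransfer.BVhat, BetaTransfer.IsEigenfunctional β hβ 1 ν' →
        BetaTransfer.IsBoundedFunctional ν' → ∃ c : ℂ, ν' = c • ν) := by
  refine ⟨?_, BetaTransfer.integralHat, BetaTransfer.isEigenfunctional_integralHat hβ,
    BetaTransfer.isBoundedFunctional_of_le_bvNorm zero_le_one BetaTransfer.norm_integralHat_le,
    BetaTransfer.integralHat_toHat, fun ν' hν' hb => ⟨_, BetaTransfer.eq_smul_integralHat hβ hν' hb⟩⟩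
  rintro lam ⟨-, hlam, hne⟩ ν hν ⟨m, hm⟩
  exact hne (BetaTransfer.eigenvalue_eq_one_of_complexMeasure hβ hlam hν hm)
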